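/- Let $d\ge 3$. A polytope of type $(n,d)$ is a bounded $d$-dimensional convex polytope in $\mathbb{R}^d$ with exactly $n$ facets $F_1,\dots,F_n$, lying in hyperplanes $\pi_1,\dots,\pi_n$. It is simple if every vertex lies on exactly $d$ facets. Paths, lengths and distances are taken in its vertex-edge graph. It is a Hirsch polytope if this graph has diameter at most $n-d$. A Dantzig figure is a triple $(P,x,y)$ in which $P$ is a simple $d$-polytope with exactly $2d$ facets and $x,y$ are vertices of $P$ such that $d$ of the facets contain $x$ and the other $d$ contain $y$. It is Dantzig-Hirsch if the distance from $x$ to $y$ is at most $d$. A fundamental deformation is a family $P(t)$, $0\le t\le 1$, of polytopes of type $(n,d)$ for which there is an index $i$ such that the facet hyperplanes $\pi_j$, $j\ne i$, do not depend on $t$, the hyperplane $\pi_i(t)$ depends continuously on $t$, and: (1) there is $t_0\in(0,1)$ such that $P(t)$ is simple exactly for $t\neq t_0$; (2) among the vertices of $P(0)$ not on $\pi_i(0)$ exactly one, $v$, lies on some $\pi_i(t)$; moreover $v\in\pi_i(t_0)$, and $v\notin P(t)$ for $t>t_0$; (3) $P(t)\subseteq P(s)$ for $t>s$; (4) exactly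 one edge of $P(0)$ vanishes, that is, is such that the facets of $P(1)$ corresponding to the facets of $P(0)$ containing this edge have no common point. It is called the vanishing edge. A pair of vertices of $P(0)$ is called good if some path of minimum length joining the two vertices either traverses the vanishing edge or does not touch it. The fundamental deformation is good if every pair of vertices not on the vanishing edge is good and, for every vertex $x$ not on the vanishing edge, $x$ forms a good pair with at least one of the two endpoints of the vanishing edge. A fundamental deformation of a Dantzig figure $(P,x,y)$ is a fundamental deformation with $P(0)=P$ whose vanishing edge contains neither $x$ nor $y$; its result is $(P(1),x',y')$, where $x',y'$ are the vertices of $P(1)$ lying on the facets corresponding to those through $x$, respectively $y$. It is good if the pair $\{x,y\}$ is good. A good deformation is a finite iteration of good fundamental deformations (of polytopes, respectively of Dantzig figures). Then every polytope obtained from a Hirsch polytope by a good deformation is a Hirsch polytope, and every triple obtained from a Dantzig-Hirsch figure by a good deformation is a Dantzig-Hirsch figure. -/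

import Mathlib

/-- A finite list of closed half-spaces `⟪normal j, x⟫ ≤ offset j` of Euclidean space `ℝ^d`. -/
structure HalfspaceSystem (d n : ℕ) where
  normal : Fin n → EuclideanSpace ℝ (Fin d)
  offset : Fin n → ℝ

namespace HalfspaceSystem

variable {d n : ℕ}

/-- The intersection of the half-spaces. -/
def carrier (P : HalfspaceSystem d n) : Set (EuclideanSpace ℝ (Fin d)) :=
  {x | ∀ j, inner ℝ (P.normal j) x ≤ P.offset j}

/-- The `j`-th bounding hyperplane. -/
def hyperplane (P : HalfspaceSystem d n) (j : Fin n) : Set (EuclideanSpace ℝ (Fin d)) :=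
  {x | inner ℝ (P.normal j) x = P.offset j}

/-- The face cut out by the `j`-th bounding hyperplane. -/
def facet (P : HalfspaceSystem d n) (j : Fin n) : Set (EuclideanSpace ℝ (Fin d)) :=
  P.carrier ∩ P.hyperplane j

end HalfspaceSystem

/-- A convex polytope of type `(n, d)`: a bounded `d`-dimensional intersection of `n` half-spaces
of `ℝ^d` whose `n` bounding hyperplanes cut out `n` distinct faces of dimension `d - 1`.
(So the facets of the polytope are exactly these `n` faces, numbered by `Fin n`.) -/
structure ConvexPolytope (d n : ℕ) extends HalfspaceSystem d n where
  normal_ne_zero : ∀ j, normal j ≠ 0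
  isBounded_carrier : Bornology.IsBounded toHalfspaceSystem.carrier
  nonempty_interior : (interior toHalfspaceSystem.carrier).Nonempty
  finrank_facet : ∀ j, Module.finrank ℝ (vectorSpan ℝ (toHalfspaceSystem.facet j)) + 1 = d
  facet_injective : Function.Injective toHalfspaceSystem.facet

namespace ConvexPolytope

variable {d n : ℕ}

/-- The vertices of a polytope are its extreme points. -/
def Vertex (P : ConvexPolytope d n) : Type :=
  {x : EuclideanSpace ℝ (Fin d) // x ∈ P.carrier.extremePoints ℝ}

/-- The underlying point of a vertex. -/
def Vertex.point {P : ConvexPolytope d n} (x : P.Vertex) : EuclideanSpace ℝ (Fin d) := x.1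

/-- The graph of a polytope: distinct vertices are adjacent when the segment between them is a
face (an edge) of the polytope. -/
def graph (P : ConvexPolytope d n) : SimpleGraph P.Vertex where
  Adj x y := x ≠ y ∧ IsExtreme ℝ P.carrier (segment ℝ x.point y.point)
  symm := ⟨fun x y h => ⟨h.1.symm, by rw [segment_symm]; exact h.2⟩⟩
  loopless := ⟨fun _ h => h.1 rfl⟩

/-- A polytope is simple if each of its vertices lies on exactly `d` facets. -/
def IsSimple (P : ConvexPolytope d n) : Prop :=
  ∀ x : P.Vertex, {j : Fin n | x.point ∈ P.hyperplane j}.ncard = d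

/-- The Hirsch bound: the diameter of the graph is at most `n - d`. -/
def IsHirsch (P : ConvexPolytope d n) : Prop :=
  P.graph.ediam + (d : ℕ∞) ≤ (n : ℕ∞)

/-- Let the facets of `P` and `Q` be numbered alike. The edge of `P` joining `x` and `y` vanishes
in `Q` if the facets of `Q` that correspond to the facets of `P` containing this edge have no
common point. -/
def EdgeVanishes (P Q : ConvexPolytope d n) (x y : P.Vertex) : Prop :=
  P.graph.Adj x y ∧
    ¬ ∃ z ∈ Q.carrier, ∀ j, x.point ∈ P.hyperplane j → y.point ∈ P.hyperplane j →
      z ∈ Q.hyperplane j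

/-- The family `P t`, `0 ≤ t ≤ 1`, is a fundamental deformation moving the `i`-th facet, singular
at the time `t₀`, with vanishing edge `pq`. -/
structure IsFundamentalDeformation (P : unitInterval → ConvexPolytope d n) (i : Fin n)
    (t₀ : unitInterval) (p q : (P 0).Vertex) : Prop where
  /-- All hyperplanes but the `i`-th are fixed. -/
  fixed : ∀ j, j ≠ i → ∀ t, (P t).normal j = (P 0).normal j ∧ (P t).offset j = (P 0).offset j
  /-- The `i`-th hyperplane moves continuously. -/
  continuous_normal : Continuous fun t => (P t).normal i
  continuous_offset : Continuous fun t => (P t).offset i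
  pos : 0 < t₀
  lt_one : t₀ < 1
  /-- The polytope is simple at all times except `t₀`. -/
  isSimple_iff : ∀ t, (P t).IsSimple ↔ t ≠ t₀
  /-- Exactly one vertex `v` of `P 0` off the `i`-th facet is passed by the moving hyperplane:
  it is met at the time `t₀` and lies outside the polytope afterwards. -/
  passed : ∃ v : (P 0).Vertex, v.point ∉ (P 0).hyperplane i ∧ v.point ∈ (P t₀).hyperplane i ∧
    (∀ t, t₀ < t → v.point ∉ (P t).carrier) ∧
    ∀ u : (P 0).Vertex, u.point ∉ (P 0).hyperplane i →
      (∃ t, u.point ∈ (P t).hyperplane i) → u = v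
  /-- The polytopes decrease. -/
  antitone : Antitone fun t => (P t).carrier
  /-- Just one edge vanishes in the process, the edge `pq`. -/
  vanishing : ∀ x y : (P 0).Vertex, EdgeVanishes (P 0) (P 1) x y ↔ s(x, y) = s(p, q)

/-- Some path of minimum length from `x` to `y` either traverses the edge `pq`
or does not touch it. -/
def HasGoodGeodesic (P : ConvexPolytope d n) (p q x y : P.Vertex) : Prop :=
  ∃ γ : P.graph.Walk x y, γ.length = P.graph.dist x y ∧
    (s(p, q) ∈ γ.edges ∨ (p ∉ γ.support ∧ q ∉ γ.support))

/-- The edge `pq` is good. Pairs of vertices off the edge must be joined by a good geodesic. From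
a vertex `x` off the edge, a good geodesic to one of the two ends `p`, `q` is enough. (A geodesic
from `x` to `p` is good only if its last step is `qp`, so good geodesics to both ends
never exist.) -/
def IsGoodEdge (P : ConvexPolytope d n) (p q : P.Vertex) : Prop :=
  (∀ x y : P.Vertex, x ≠ p → x ≠ q → y ≠ p → y ≠ q → P.HasGoodGeodesic p q x y) ∧
  (∀ x : P.Vertex, x ≠ p → x ≠ q → P.HasGoodGeodesic p q x p ∨ P.HasGoodGeodesic p q x q)

/-- The second polytope is the end of a good fundamental deformation of the first. -/
inductive GoodStep : ConvexPolytope d n → ConvexPolytope d n → Prop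
  | intro (P : unitInterval → ConvexPolytope d n) (i : Fin n) (t₀ : unitInterval)
      (p q : (P 0).Vertex) (hP : IsFundamentalDeformation P i t₀ p q)
      (good : (P 0).IsGoodEdge p q) : GoodStep (P 0) (P 1)

/-- `Q` is a good deformation of `P`: an iterate of good fundamental deformations. -/
def IsGoodDeformation (P Q : ConvexPolytope d n) : Prop :=
  Relation.ReflTransGen GoodStep P Q

end ConvexPolytope

/-- A polytope with two marked vertices. -/
structure MarkedPolytope (d n : ℕ) where
  poly : ConvexPolytope d n
  x : poly.Vertex
  y : poly.Vertex

namespace MarkedPolytope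

variable {d : ℕ}

/-- A `d`-dimensional Dantzig figure: a simple polytope with `2d` facets, each of which contains
exactly one of the two marked vertices (so `d` of them contain `x`, the other `d` contain `y`). -/
def IsDantzigFigure (A : MarkedPolytope d (2 * d)) : Prop :=
  A.poly.IsSimple ∧
    ∀ j, A.x.point ∈ A.poly.hyperplane j ↔ A.y.point ∉ A.poly.hyperplane j

/-- A Dantzig figure whose marked vertices are at distance at most `d`. -/
def IsDantzigHirsch (A : MarkedPolytope d (2 * d)) : Prop :=
  A.IsDantzigFigure ∧ A.poly.graph.edist A.x A.y ≤ (d : ℕ∞)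

/-- The second figure is the end of a good fundamental deformation of the first: the vanishing
edge contains neither marked vertex, the marked vertices are joined by a good geodesic, and they
are carried to the vertices that lie on the corresponding facets. -/
inductive GoodStep : MarkedPolytope d (2 * d) → MarkedPolytope d (2 * d) → Prop
  | intro (P : unitInterval → ConvexPolytope d (2 * d)) (i : Fin (2 * d)) (t₀ : unitInterval)
      (p q : (P 0).Vertex) (hP : ConvexPolytope.IsFundamentalDeformation P i t₀ p q)
      (x y : (P 0).Vertex) (hxp : x ≠ p) (hxq : x ≠ q) (hyp : y ≠ p) (hyq : y ≠ q)
      (good : (P 0).HasGoodGeodesic p q x y) (x' y' : (P 1).Vertex)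
      (hx' : ∀ j, x'.point ∈ (P 1).hyperplane j ↔ x.point ∈ (P 0).hyperplane j)
      (hy' : ∀ j, y'.point ∈ (P 1).hyperplane j ↔ y.point ∈ (P 0).hyperplane j) :
      GoodStep ⟨P 0, x, y⟩ ⟨P 1, x', y'⟩

/-- `B` is a good deformation of `A`: an iterate of good fundamental deformations of Dantzig
figures. -/
def IsGoodDeformation (A B : MarkedPolytope d (2 * d)) : Prop :=
  Relation.ReflTransGen GoodStep A B

end MarkedPolytope

/-! A fundamental deformation changes the combinatorics of a simple polytope by one flip. Let B be
the set of the d - 1 facets through the vanishing edge, with a and i the remaining facets at its two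
ends. The ends B ∪ {a} and B ∪ {i} disappear, the vertices {a, i} ∪ B \ {b} with b ∈ B appear, and
every other vertex keeps its set of facets. This is `IsEdgeFlip`, proved in `exists_isEdgeFlip`.

Distances then follow from the facet sets alone, since vertices of a simple polytope are adjacent
exactly when they share all facets but one. The new vertices are pairwise adjacent, and an old
neighbour of an end of the edge is adjacent to some new vertex. A geodesic that avoids the edge is
copied. One that traverses it is rerouted: its two outer pieces end on new vertices, and one step
between these replaces the traversal. A good geodesic from x to an end of the edge must traverse the
edge, so its length also bounds the distance from x to every new vertex. Hence neither the diameter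
nor the distance of a good pair grows (`ediam_le`, `edist_le_of_hasGoodGeodesic`).

The geometry rests on the passed vertex v. Every edge from v to the moving facet vanishes, so
uniqueness of the vanishing edge leaves at most one. There is at least one, since otherwise the
moving facet would be the single point v at time t₀. All other vertices off the moving facet stay
strictly inside the moving half-space. -/

/-! ### Active constraints and extreme points -/

namespace HalfspaceSystem

open Filter Topology

variable {d n : ℕ}

/-- The indices of the bounding hyperplanes through a point. -/
def active (P : HalfspaceSystem d n) (x : EuclideanSpace ℝ (Fin d)) : Set (Fin n) :=
  {j | x ∈ P.hyperplane j}

theorem mem_active {P : HalfspaceSystem d n} {x : EuclideanSpace ℝ (Fin d)} {j : Fin n} :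
    j ∈ P.active x ↔ inner ℝ (P.normal j) x = P.offset j := Iff.rfl

theorem inner_lt_of_notMem_active {P : HalfspaceSystem d n} {x : EuclideanSpace ℝ (Fin d)}
    (hx : x ∈ P.carrier) {j : Fin n} (hj : j ∉ P.active x) :
    inner ℝ (P.normal j) x < P.offset j :=
  lt_of_le_of_ne (hx j) hj

/-- A slack constraint survives a short move by continuity; a tight one survives because it does not
increase along e. -/
theorem eventually_inner_add_smul_le {a x e : EuclideanSpace ℝ (Fin d)} {c : ℝ}
    (hx : inner ℝ a x ≤ c) (he : inner ℝ a x = c → inner ℝ a e ≤ 0) :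
    ∀ᶠ s : ℝ in 𝓝[>] 0, inner ℝ a (x + s • e) ≤ c := by
  rcases hx.lt_or_eq with h | h
  · have hc : Continuous fun s : ℝ => inner ℝ a (x + s • e) := by fun_prop
    have : ∀ᶠ s : ℝ in 𝓝 0, inner ℝ a (x + s • e) < c :=
      hc.continuousAt.eventually_lt continuousAt_const (by simpa using h)
    exact (this.filter_mono nhdsWithin_le_nhds).mono fun s hs => hs.le
  · filter_upwards [self_mem_nhdsWithin] with s hs
    rw [inner_add_right, inner_smul_right, h]
    have := mul_nonpos_of_nonneg_of_nonpos (le_of_lt hs) (he h)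
    linarith

theorem exists_add_smul_mem {P : HalfspaceSystem d n} {x e : EuclideanSpace ℝ (Fin d)}
    (hx : x ∈ P.carrier) (he : ∀ j ∈ P.active x, inner ℝ (P.normal j) e ≤ 0) :
    ∃ s : ℝ, 0 < s ∧ x + s • e ∈ P.carrier := by
  have h : ∀ᶠ s : ℝ in 𝓝[>] 0, ∀ j, inner ℝ (P.normal j) (x + s • e) ≤ P.offset j :=
    eventually_all.2 fun j => eventually_inner_add_smul_le (hx j) (he j)
  obtain ⟨s, hs, hs'⟩ := (h.and self_mem_nhdsWithin).exists
  exact ⟨s, hs', hs⟩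

/-- If a point of an open segment lies on a bounding hyperplane, so does the whole segment. -/
theorem active_subset_of_mem_openSegment {P : HalfspaceSystem d n}
    {x y z : EuclideanSpace ℝ (Fin d)} (hx : x ∈ P.carrier) (hy : y ∈ P.carrier)
    (hz : z ∈ openSegment ℝ x y) : P.active z ⊆ P.active x := by
  obtain ⟨s, t, hs, ht, hst, rfl⟩ := hz
  intro j hj
  rw [mem_active] at hj ⊢
  rw [inner_add_right, inner_smul_right, inner_smul_right] at hj
  have h1 := hx j
  have h2 := hy j
  refine le_antisymm h1 ?_
  have : s * inner ℝ (P.normal j) x + t * P.offset j ≥ (s + t) * P.offset j := by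
    rw [hst, one_mul]
    nlinarith
  nlinarith

/-- A direction orthogonal to all active normals can be followed both ways, so it would put x inside
a segment. This turns extremality into linear algebra on the active normals. -/
theorem mem_extremePoints_iff {P : HalfspaceSystem d n} {x : EuclideanSpace ℝ (Fin d)}
    (hx : x ∈ P.carrier) :
    x ∈ P.carrier.extremePoints ℝ ↔
      ∀ e, (∀ j ∈ P.active x, inner ℝ (P.normal j) e = 0) → e = 0 := by
  constructor
  · intro h e he
    by_contra hne
    obtain ⟨s, hs, h1⟩ := exists_add_smul_mem hx fun j hj => (he j hj).le
    obtain ⟨t, ht, h2⟩ := exists_add_smul_mem (e := -e) hx fun j hj => by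
      rw [inner_neg_right, he j hj, neg_zero]
    have : x ∈ openSegment ℝ (x + s • e) (x + t • -e) := by
      refine ⟨t / (s + t), s / (s + t), by positivity, by positivity, by field_simp; ring, ?_⟩
      have hst : s + t ≠ 0 := by positivity
      ext k
      simp
      field_simp
      ring
    have h3 := h.2 h1 h2 this
    have h4 : s • e = 0 := by simpa using h3
    exact hne ((smul_eq_zero.1 h4).resolve_left hs.ne')
  · intro h
    refine ⟨hx, fun y hy z hz hxyz => ?_⟩
    have hyx := active_subset_of_mem_openSegment hy hz hxyz
    have := h (y - x) fun j hj => by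
      rw [inner_sub_right, mem_active.1 (hyx hj), mem_active.1 hj, sub_self]
    exact sub_eq_zero.1 this

end HalfspaceSystem

/-! ### Vertices and edges of simple polytopes -/

namespace ConvexPolytope

open HalfspaceSystem

variable {d n : ℕ} {P : ConvexPolytope d n}

/-- The indices of the facets through a vertex. -/
def Vertex.active (x : P.Vertex) : Set (Fin n) := P.toHalfspaceSystem.active x.point

theorem Vertex.mem_active {x : P.Vertex} {j : Fin n} :
    j ∈ x.active ↔ inner ℝ (P.normal j) x.point = P.offset j := Iff.rfl

theorem Vertex.mem_carrier (x : P.Vertex) : x.point ∈ P.carrier := x.2.1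

theorem Vertex.inner_lt (x : P.Vertex) {j : Fin n} (hj : j ∉ x.active) :
    inner ℝ (P.normal j) x.point < P.offset j :=
  inner_lt_of_notMem_active x.mem_carrier hj

theorem Vertex.ext_point {x y : P.Vertex} (h : x.point = y.point) : x = y := Subtype.ext h

theorem Vertex.eq_zero_of_inner (x : P.Vertex) {e : EuclideanSpace ℝ (Fin d)}
    (he : ∀ j ∈ x.active, inner ℝ (P.normal j) e = 0) : e = 0 :=
  (mem_extremePoints_iff x.mem_carrier).1 x.2 e he

theorem Vertex.eq_of_active_subset (x : P.Vertex) {z : EuclideanSpace ℝ (Fin d)}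
    (hz : x.active ⊆ P.toHalfspaceSystem.active z) : z = x.point := by
  refine sub_eq_zero.1 (x.eq_zero_of_inner fun j hj => ?_)
  rw [inner_sub_right, HalfspaceSystem.mem_active.1 (hz hj), mem_active.1 hj, sub_self]

theorem IsSimple.ncard_active (hP : P.IsSimple) (x : P.Vertex) : x.active.ncard = d := hP x

/-- A vertex of a simple polytope whose facets are among `d` given ones. -/
theorem IsSimple.active_eq (hP : P.IsSimple) (x : P.Vertex) {S : Set (Fin n)}
    (hS : S ⊆ x.active) (hcard : d ≤ S.ncard) : x.active = S :=
  (Set.eq_of_subset_of_ncard_le hS (by rw [hP.ncard_active x]; exact hcard)).symm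

/-- The outgoing edge directions at a vertex of a simple polytope. -/
theorem IsSimple.exists_direction (hP : P.IsSimple) (x : P.Vertex) :
    ∃ e : Fin n → EuclideanSpace ℝ (Fin d), ∀ k ∈ x.active, ∀ j ∈ x.active,
      inner ℝ (P.normal j) (e k) = if j = k then -1 else 0 := by
  classical
  -- Pairing with the d active normals is injective because x is extreme, hence bijective by
  -- dimension; the directions are the negated dual basis.
  let f : EuclideanSpace ℝ (Fin d) →ₗ[ℝ] (x.active → ℝ) :=
    LinearMap.pi fun j => (innerSL ℝ (P.normal j)).toLinearMap
  have hf : Function.Injective f := by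
    rw [← LinearMap.ker_eq_bot, LinearMap.ker_eq_bot']
    intro e he
    refine x.eq_zero_of_inner fun j hj => ?_
    exact congrFun he ⟨j, hj⟩
  have hcard : Fintype.card x.active = d := by
    rw [← Nat.card_eq_fintype_card]
    exact hP.ncard_active x
  have hs : Function.Surjective f := by
    refine (LinearMap.injective_iff_surjective_of_finrank_eq_finrank ?_).1 hf
    simp [hcard]
  choose g hg using fun k : Fin n => hs fun j => if (j : Fin n) = k then -1 else 0
  exact ⟨g, fun k _ j hj => congrFun (hg k) ⟨j, hj⟩⟩

theorem isCompact_carrier (P : ConvexPolytope d n) : IsCompact P.carrier := by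
  refine Metric.isCompact_of_isClosed_isBounded ?_ P.isBounded_carrier
  have : P.carrier = ⋂ j, {x | inner ℝ (P.normal j) x ≤ P.offset j} := by
    ext x; simp [carrier]
  rw [this]
  exact isClosed_iInter fun j => isClosed_le (by fun_prop) continuous_const

/-- By compactness there is a last point of the ray in the polytope; some constraint active there
must increase along e, or the ray could go on. -/
theorem exists_exit (P : ConvexPolytope d n) {x e : EuclideanSpace ℝ (Fin d)}
    (hx : x ∈ P.carrier) (he : e ≠ 0) :
    ∃ s : ℝ, 0 ≤ s ∧ x + s • e ∈ P.carrier ∧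
      ∃ j ∈ P.toHalfspaceSystem.active (x + s • e), 0 < inner ℝ (P.normal j) e := by
  have hcont : Continuous fun s : ℝ => x + s • e := by fun_prop
  let S : Set ℝ := Set.Ici 0 ∩ (fun s : ℝ => x + s • e) ⁻¹' P.carrier
  have hS : IsCompact S := by
    refine Metric.isCompact_of_isClosed_isBounded
      (isClosed_Ici.inter (P.isCompact_carrier.isClosed.preimage hcont)) ?_
    obtain ⟨R, hR⟩ := P.isBounded_carrier.exists_norm_le
    refine (Metric.isBounded_Icc (0 : ℝ) ((R + ‖x‖) / ‖e‖)).subset fun s hs => ⟨hs.1, ?_⟩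
    rw [le_div_iff₀ (norm_pos_iff.2 he)]
    have h1 := hR _ hs.2
    have h2 : s • e = (x + s • e) - x := by abel
    have h3 := norm_sub_le (x + s • e) x
    rw [← h2, norm_smul, Real.norm_of_nonneg hs.1] at h3
    linarith
  obtain ⟨s, hs, hmax⟩ := hS.exists_isGreatest ⟨0, by simp, by simpa using hx⟩
  refine ⟨s, hs.1, hs.2, ?_⟩
  by_contra! hcon
  obtain ⟨t, ht, hmem⟩ := exists_add_smul_mem hs.2 hcon
  have hst : s + t ∈ S := ⟨add_nonneg hs.1 ht.le, by
    have : x + (s + t) • e = x + s • e + t • e := by rw [add_smul, add_assoc]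
    simpa [this] using hmem⟩
  have := hmax hst
  linarith

/-- The other end of the edge that leaves the `k`-th facet at a vertex. -/
theorem IsSimple.exists_neighbor (hP : P.IsSimple) (x : P.Vertex) {k : Fin n}
    (hk : k ∈ x.active) :
    ∃ y : P.Vertex, k ∉ y.active ∧ ∃ j, j ∉ x.active ∧ y.active = insert j (x.active \ {k}) := by
  obtain ⟨e, he⟩ := hP.exists_direction x
  have hkk := he k hk k hk
  rw [if_pos rfl] at hkk
  have hjk : ∀ j ∈ x.active, j ≠ k → inner ℝ (P.normal j) (e k) = 0 := fun j hj hne => by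
    rw [he k hk j hj, if_neg hne]
  have hne : e k ≠ 0 := by
    intro h
    rw [h, inner_zero_right] at hkk
    norm_num at hkk
  obtain ⟨s, hs, hmem, j, hj, hpos⟩ := P.exists_exit x.mem_carrier hne
  have hjx : j ∉ x.active := by
    intro hjx
    rw [he k hk j hjx] at hpos
    split_ifs at hpos <;> norm_num at hpos
  have hs0 : 0 < s := by
    refine hs.lt_of_ne fun h => hjx ?_
    rw [← h, zero_smul, add_zero] at hj
    exact hj
  have hsub : insert j (x.active \ {k}) ⊆ P.toHalfspaceSystem.active (x.point + s • e k) := by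
    refine Set.insert_subset hj fun l hl => ?_
    rw [HalfspaceSystem.mem_active, inner_add_right, inner_smul_right, hjk l hl.1 hl.2, mul_zero,
      add_zero]
    exact hl.1
  have hext : x.point + s • e k ∈ P.carrier.extremePoints ℝ := by
    refine (mem_extremePoints_iff hmem).2 fun f hf => ?_
    -- Among the directions killed by the facets of x other than k, only multiples of e k remain,
    -- and the new facet j is not parallel to e k.
    have h1 : f + (inner ℝ (P.normal k) f) • e k = 0 := by
      refine x.eq_zero_of_inner fun l hl => ?_
      rw [inner_add_right, inner_smul_right]
      by_cases hlk : l = k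
      · rw [hlk, hkk]; ring
      · rw [hjk l hl hlk, hf l (hsub (Or.inr ⟨hl, hlk⟩))]; ring
    have h2 := congrArg (fun g => inner ℝ (P.normal j) g) h1
    simp only [inner_add_right, inner_smul_right, inner_zero_right, hf j (hsub (Or.inl rfl)),
      zero_add] at h2
    have h3 := (mul_eq_zero.1 h2).resolve_right hpos.ne'
    simpa [h3] using h1
  refine ⟨⟨_, hext⟩, ?_, j, hjx, hP.active_eq ⟨_, hext⟩ hsub ?_⟩
  · intro h
    have h : inner ℝ (P.normal k) (x.point + s • e k) = P.offset k := h
    rw [inner_add_right, inner_smul_right, hkk, Vertex.mem_active.1 hk] at h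
    linarith
  · rw [Set.ncard_insert_of_notMem (fun h => hjx h.1), Set.ncard_sdiff_singleton_add_one hk,
      hP.ncard_active x]

/-- The points of a polytope that lie on all facets but one through a vertex `x`
fill the segment from `x` to any other vertex among them. -/
theorem Vertex.mem_segment {x y : P.Vertex} (hxy : x ≠ y) {k : Fin n}
    (hy : x.active \ {k} ⊆ y.active) {z : EuclideanSpace ℝ (Fin d)} (hz : z ∈ P.carrier)
    (hz' : x.active \ {k} ⊆ P.toHalfspaceSystem.active z) : z ∈ segment ℝ x.point y.point := by
  have hzero : ∀ w, x.active \ {k} ⊆ P.toHalfspaceSystem.active w → ∀ j ∈ x.active, j ≠ k →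
      inner ℝ (P.normal j) (w - x.point) = 0 := fun w hw j hj hne => by
    rw [inner_sub_right, HalfspaceSystem.mem_active.1 (hw ⟨hj, hne⟩), mem_active.1 hj, sub_self]
  have hky : inner ℝ (P.normal k) (y.point - x.point) ≠ 0 := fun h => by
    refine hxy (ext_point (sub_eq_zero.1 (x.eq_zero_of_inner fun j hj => ?_)).symm)
    by_cases hjk : j = k
    · rw [hjk, h]
    · exact hzero _ hy j hj hjk
  set c := inner ℝ (P.normal k) (z - x.point) / inner ℝ (P.normal k) (y.point - x.point) with hc
  have hzc : z = x.point + c • (y.point - x.point) := by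
    have : (z - x.point) - c • (y.point - x.point) = 0 := by
      refine x.eq_zero_of_inner fun j hj => ?_
      rw [inner_sub_right, inner_smul_right]
      by_cases hjk : j = k
      · rw [hjk, hc, div_mul_cancel₀ _ hky, sub_self]
      · rw [hzero _ hy j hj hjk, hzero _ hz' j hj hjk]; ring
    rw [← sub_eq_zero.1 this]; abel
  have hne : y.point - x.point ≠ 0 := fun h => hky (by rw [h, inner_zero_right])
  -- If c < 0, then x lies strictly between z and y; if c > 1, then y lies strictly between x and z.
  -- Both contradict extremality.
  have hc0 : 0 ≤ c := by
    by_contra! hneg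
    have hmem : x.point ∈ openSegment ℝ z y.point := by
      have h1 : 1 - c ≠ 0 := by linarith
      refine ⟨1 / (1 - c), -c / (1 - c), div_pos one_pos (by linarith),
        div_pos (by linarith) (by linarith), by field_simp; ring, ?_⟩
      rw [hzc]
      ext l
      simp
      field_simp
      ring
    have h1 := x.2.2 hz y.mem_carrier hmem
    have h2 : c • (y.point - x.point) = 0 := by
      have h3 : z = x.point := h1
      rw [hzc] at h3
      simpa using h3
    exact hneg.ne ((smul_eq_zero.1 h2).resolve_right hne)
  have hc1 : c ≤ 1 := by
    by_contra! hgt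
    have hmem : y.point ∈ openSegment ℝ x.point z := by
      have h1 : c ≠ 0 := by linarith
      refine ⟨(c - 1) / c, 1 / c, div_pos (by linarith) (by linarith), by positivity,
        by field_simp; ring, ?_⟩
      rw [hzc]
      ext l
      simp
      field_simp
      ring
    have h1 : x.point = y.point := y.2.2 x.mem_carrier hz hmem
    exact hxy (ext_point h1)
  rw [segment_eq_image']
  exact ⟨c, ⟨hc0, hc1⟩, hzc.symm⟩

/-- There is only one further vertex on an edge. -/
theorem Vertex.eq_of_active_diff_subset {x y z : P.Vertex} (hxy : x ≠ y) (hxz : x ≠ z) {k : Fin n}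
    (hy : x.active \ {k} ⊆ y.active) (hz : x.active \ {k} ⊆ z.active) : z = y := by
  have h := mem_segment hxy hy z.mem_carrier hz
  by_contra hne
  have : z.point ∈ openSegment ℝ x.point y.point :=
    mem_openSegment_of_ne_left_right (fun h => hxz (ext_point h))
      (fun h => hne (ext_point h.symm)) h
  exact hxz (ext_point (z.2.2 x.mem_carrier y.mem_carrier this))

theorem adj_of_active_diff_subset {x y : P.Vertex} (hxy : x ≠ y) {k : Fin n}
    (hy : x.active \ {k} ⊆ y.active) : P.graph.Adj x y := by
  have hconv : Convex ℝ P.carrier := by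
    have : P.carrier = ⋂ j, {x | inner ℝ (P.normal j) x ≤ P.offset j} := by
      ext x; simp [carrier]
    rw [this]
    exact convex_iInter fun j => convex_halfSpace_le (innerSL ℝ (P.normal j)).toLinearMap.isLinear _
  have hseg : ∀ z ∈ segment ℝ x.point y.point,
      x.active \ {k} ⊆ P.toHalfspaceSystem.active z := by
    rintro _ ⟨s, t, -, -, hst, rfl⟩ j hj
    rw [HalfspaceSystem.mem_active, inner_add_right, inner_smul_right, inner_smul_right]
    change s * inner ℝ _ x.point + t * inner ℝ _ y.point = _
    have h1' := Vertex.mem_active.1 (hy hj)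
    have h2' := Vertex.mem_active.1 hj.1
    rw [h1', h2', ← add_mul, hst, one_mul]
  refine ⟨hxy, hconv.segment_subset x.mem_carrier y.mem_carrier, ?_⟩
  intro z hz w hw u hu huzw
  exact Vertex.mem_segment hxy hy hz
    ((hseg u hu).trans (active_subset_of_mem_openSegment hz hw huzw))

/-- If two facets k, l of x both missed y, the directions e k and e l would be tangent to every
facet through the midpoint of the edge. Extremality of the edge would make both parallel to y - x,
but they are independent. -/
theorem IsSimple.exists_active_diff_subset (hP : P.IsSimple) {x y : P.Vertex}
    (h : P.graph.Adj x y) : ∃ k ∈ x.active, x.active \ {k} ⊆ y.active := by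
  obtain ⟨hne, hext⟩ := h
  by_contra! hcon
  obtain ⟨k, hk, hky⟩ : ∃ k ∈ x.active, k ∉ y.active := by
    by_contra! hsub
    exact hne (Vertex.ext_point (x.eq_of_active_subset hsub)).symm
  obtain ⟨l, ⟨hl, hlk⟩, hly⟩ := Set.not_subset.1 (hcon k hk)
  obtain ⟨e, he⟩ := hP.exists_direction x
  have hconv := hext.subset
  set m := midpoint ℝ x.point y.point with hm
  have hmo : m ∈ openSegment ℝ x.point y.point := by
    refine ⟨1 / 2, 1 / 2, by norm_num, by norm_num, by norm_num, ?_⟩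
    rw [hm, midpoint_eq_smul_add, smul_add]
    norm_num
  have hms : m ∈ segment ℝ x.point y.point := openSegment_subset_segment _ _ _ hmo
  have hmx := active_subset_of_mem_openSegment x.mem_carrier y.mem_carrier hmo
  have hmy := active_subset_of_mem_openSegment y.mem_carrier x.mem_carrier
    (by rwa [openSegment_symm])
  have key : ∀ r ∈ x.active, r ∉ y.active → ∃ c : ℝ, e r = c • (y.point - x.point) := by
    intro r hr hry
    have hzero : ∀ j ∈ P.toHalfspaceSystem.active m, inner ℝ (P.normal j) (e r) = 0 :=
      fun j hj => by
        rw [he r hr j (hmx hj), if_neg]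
        rintro rfl
        exact hry (hmy hj)
    obtain ⟨s, hs, h1⟩ := exists_add_smul_mem (P := P.toHalfspaceSystem) (hconv hms)
      fun j hj => (hzero j hj).le
    obtain ⟨t, ht, h2⟩ := exists_add_smul_mem (P := P.toHalfspaceSystem) (e := -e r) (hconv hms)
      fun j hj => by rw [inner_neg_right, hzero j hj, neg_zero]
    have hmid : m ∈ openSegment ℝ (m + s • e r) (m + t • -e r) := by
      refine ⟨t / (s + t), s / (s + t), by positivity, by positivity, by field_simp; ring, ?_⟩
      have hst : s + t ≠ 0 := by positivity
      ext k
      simp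
      field_simp
      ring
    have h3 := hext.left_mem_of_mem_openSegment h1 h2 hms hmid
    rw [segment_eq_image'] at h3
    obtain ⟨θ, -, hθ⟩ := h3
    refine ⟨(θ - 1 / 2) / s, ?_⟩
    have h4 : s • e r = (θ - 1 / 2) • (y.point - x.point) := by
      have h5 : s • e r = x.point + θ • (y.point - x.point) - m := by
        rw [eq_sub_iff_add_eq, add_comm]; exact hθ.symm
      rw [h5, hm, midpoint_eq_smul_add]
      ext k
      simp
      ring
    rw [div_eq_inv_mul, mul_smul, ← h4, smul_smul, inv_mul_cancel₀ hs.ne', one_smul]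
  obtain ⟨c, hc⟩ := key k hk hky
  obtain ⟨c', hc'⟩ := key l hl hly
  have h1 := he k hk k hk
  have h2 := he l hl k hk
  have h3 := he l hl l hl
  rw [if_pos rfl, hc, inner_smul_right] at h1
  rw [if_neg (fun h => hlk h.symm), hc', inner_smul_right] at h2
  rw [if_pos rfl, hc', inner_smul_right] at h3
  rcases mul_eq_zero.1 h2 with h | h
  · rw [h, zero_mul] at h3; norm_num at h3
  · rw [h, mul_zero] at h1; norm_num at h1

theorem edist_le_one {x y : P.Vertex} {k : Fin n} (hy : x.active \ {k} ⊆ y.active) :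
    P.graph.edist x y ≤ 1 := by
  by_cases hxy : x = y
  · rw [hxy, SimpleGraph.edist_self]; exact zero_le
  · exact (SimpleGraph.edist_eq_one_iff_adj.2 (adj_of_active_diff_subset hxy hy)).le

end ConvexPolytope

/-! ### Edge flips and graph distances -/

namespace ConvexPolytope

open HalfspaceSystem

variable {d n : ℕ}

/-- The combinatorial change in a simple polytope when an edge `pq` shrinks to a point and is
replaced by a simplex: here `B` consists of the facets through the edge, while `a` and `i` are the
remaining facets through `p` and through `q`. -/
structure IsEdgeFlip (P Q : ConvexPolytope d n) (p q : P.Vertex) (B : Set (Fin n)) (a i : Fin n) :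
    Prop where
  isSimple : P.IsSimple
  ne : a ≠ i
  left_notMem : a ∉ B
  right_notMem : i ∉ B
  active_left : p.active = insert a B
  active_right : q.active = insert i B
  not_subset : ∀ x : P.Vertex, x ≠ p → x ≠ q → ¬ B ⊆ x.active
  exists_old : ∀ x : P.Vertex, x ≠ p → x ≠ q → ∃ x' : Q.Vertex, x'.active = x.active
  exists_new : ∀ b ∈ B, ∃ z : Q.Vertex, z.active = insert a (insert i (B \ {b}))
  old_or_new : ∀ z : Q.Vertex, (∃ x : P.Vertex, x ≠ p ∧ x ≠ q ∧ z.active = x.active) ∨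
    ∃ b ∈ B, z.active = insert a (insert i (B \ {b}))

namespace IsEdgeFlip

variable {P Q : ConvexPolytope d n} {p q : P.Vertex} {B : Set (Fin n)} {a i : Fin n}

theorem symm (h : IsEdgeFlip P Q p q B a i) : IsEdgeFlip P Q q p B i a where
  isSimple := h.isSimple
  ne := h.ne.symm
  left_notMem := h.right_notMem
  right_notMem := h.left_notMem
  active_left := h.active_right
  active_right := h.active_left
  not_subset x hq hp := h.not_subset x hp hq
  exists_old x hq hp := h.exists_old x hp hq
  exists_new b hb := by
    rw [Set.insert_comm]
    exact h.exists_new b hb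
  old_or_new z := by
    simp only [Set.insert_comm i a]
    exact (h.old_or_new z).imp_left fun ⟨x, hp, hq, hx⟩ => ⟨x, hq, hp, hx⟩

theorem edist_new_le_one {b c : Fin n} {z w : Q.Vertex}
    (hz : z.active = insert a (insert i (B \ {b})))
    (hw : w.active = insert a (insert i (B \ {c}))) : Q.graph.edist z w ≤ 1 := by
  refine edist_le_one (k := c) ?_
  rw [hz, hw]
  rintro j ⟨hj | hj | ⟨hj, -⟩, hjc⟩
  · exact Or.inl hj
  · exact Or.inr (Or.inl hj)
  · exact Or.inr (Or.inr ⟨hj, hjc⟩)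

theorem edist_old_le_one (h : IsEdgeFlip P Q p q B a i) {x y : P.Vertex} (hxy : P.graph.Adj x y)
    {x' y' : Q.Vertex} (hx : x'.active = x.active) (hy : y'.active = y.active) :
    Q.graph.edist x' y' ≤ 1 := by
  obtain ⟨k, -, hk⟩ := h.isSimple.exists_active_diff_subset hxy
  exact edist_le_one (k := k) (by rwa [hx, hy])

/-- The edge from p to x leaves a facet k of p. If k = a, then x would contain all of B, which only
the ends of the edge do. So k ∈ B, and x shares with the new vertex for k all of its facets except
possibly i. -/
theorem exists_edist_new_le_one (h : IsEdgeFlip P Q p q B a i) {x : P.Vertex} (hxp : P.graph.Adj p x)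
    (hxq : x ≠ q) {x' : Q.Vertex} (hx : x'.active = x.active) :
    ∃ b ∈ B, ∃ z : Q.Vertex, z.active = insert a (insert i (B \ {b})) ∧
      Q.graph.edist x' z ≤ 1 := by
  obtain ⟨k, hk, hsub⟩ := h.isSimple.exists_active_diff_subset hxp
  rw [h.active_left] at hk hsub
  rcases hk with rfl | hk
  · refine absurd (fun j hj => hsub ⟨Or.inr hj, ?_⟩) (h.not_subset x hxp.ne' hxq)
    rintro rfl
    exact h.left_notMem hj
  · obtain ⟨z, hz⟩ := h.exists_new k hk
    refine ⟨k, hk, z, hz, ?_⟩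
    rw [SimpleGraph.edist_comm]
    refine edist_le_one (k := i) ?_
    rw [hz, hx]
    rintro j ⟨rfl | hj | ⟨hj, hjk⟩, hji⟩
    · exact hsub ⟨Or.inl rfl, fun hjk => h.left_notMem (hjk ▸ hk)⟩
    · exact absurd hj hji
    · exact hsub ⟨Or.inr hj, hjk⟩

/-- A walk that ends on the edge gives a walk, no longer, that ends on the simplex. -/
theorem exists_edist_new_le_length (h : IsEdgeFlip P Q p q B a i) {x y : P.Vertex}
    (γ : P.graph.Walk x y) (hxp : x ≠ p) (hxq : x ≠ q) (hy : y = p ∨ y = q) {x' : Q.Vertex}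
    (hx : x'.active = x.active) :
    ∃ b ∈ B, ∃ z : Q.Vertex, z.active = insert a (insert i (B \ {b})) ∧
      Q.graph.edist x' z ≤ γ.length := by
  induction γ generalizing x' with
  | nil => exact absurd hy (by simp [hxp, hxq])
  | @cons u v w huv γ ih =>
    have hle : (1 : ℕ∞) ≤ (SimpleGraph.Walk.cons huv γ).length := by
      rw [SimpleGraph.Walk.length_cons]
      exact_mod_cast Nat.le_add_left 1 _
    -- Only the part up to the first visit to p or q matters: its last step is replaced by a step to
    -- a new vertex.
    by_cases hvp : v = p
    · subst hvp
      obtain ⟨b, hb, z, hz, hd⟩ := h.exists_edist_new_le_one huv.symm hxq hx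
      exact ⟨b, hb, z, hz, hd.trans hle⟩
    by_cases hvq : v = q
    · subst hvq
      obtain ⟨b, hb, z, hz, hd⟩ := h.symm.exists_edist_new_le_one huv.symm hxp hx
      exact ⟨b, hb, z, by rw [hz, Set.insert_comm], hd.trans hle⟩
    obtain ⟨v', hv'⟩ := h.exists_old v hvp hvq
    obtain ⟨b, hb, z, hz, hd⟩ := ih hvp hvq hy hv'
    refine ⟨b, hb, z, hz, SimpleGraph.edist_triangle.trans
      ((add_le_add (h.edist_old_le_one huv hx hv') hd).trans ?_)⟩
    rw [SimpleGraph.Walk.length_cons, add_comm]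
    norm_cast

theorem edist_le_length_of_notMem_support (h : IsEdgeFlip P Q p q B a i) {x y : P.Vertex}
    (γ : P.graph.Walk x y) (hp : p ∉ γ.support) (hq : q ∉ γ.support) {x' y' : Q.Vertex}
    (hx : x'.active = x.active) (hy : y'.active = y.active) :
    Q.graph.edist x' y' ≤ γ.length := by
  induction γ generalizing x' with
  | nil =>
    have : x' = y' := Vertex.ext_point (y'.eq_of_active_subset (by
      rw [hy, ← hx]; exact subset_rfl))
    rw [this, SimpleGraph.edist_self]
    exact zero_le
  | @cons u v w huv γ ih =>
    rw [SimpleGraph.Walk.support_cons, List.mem_cons, not_or] at hp hq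
    have hvp : v ≠ p := fun hv => hp.2 (hv ▸ γ.start_mem_support)
    have hvq : v ≠ q := fun hv => hq.2 (hv ▸ γ.start_mem_support)
    obtain ⟨v', hv'⟩ := h.exists_old v hvp hvq
    refine SimpleGraph.edist_triangle.trans
      ((add_le_add (h.edist_old_le_one huv hx hv') (ih hp.2 hq.2 hv' hy)).trans ?_)
    rw [SimpleGraph.Walk.length_cons, add_comm]
    norm_cast

end IsEdgeFlip

/-- A walk that traverses an edge splits there. -/
theorem exists_split_of_mem_edges {V : Type*} {G : SimpleGraph V} {p q x y : V} (γ : G.Walk x y)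
    (h : s(p, q) ∈ γ.edges) : ∃ u v, (u = p ∨ u = q) ∧ (v = p ∨ v = q) ∧
      ∃ (α : G.Walk x u) (β : G.Walk v y), α.length + 1 + β.length = γ.length := by
  induction γ with
  | nil => simp at h
  | @cons r t w hrt γ ih =>
    rw [SimpleGraph.Walk.edges_cons, List.mem_cons] at h
    rcases h with h | h
    · refine ⟨r, t, ?_, ?_, .nil, γ, by simp [add_comm]⟩ <;>
      · rw [Sym2.eq_iff] at h
        rcases h with ⟨rfl, rfl⟩ | ⟨rfl, rfl⟩ <;> simp
    · obtain ⟨u, v, hu, hv, α, β, hl⟩ := ih h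
      refine ⟨u, v, hu, hv, .cons hrt α, β, ?_⟩
      rw [SimpleGraph.Walk.length_cons, SimpleGraph.Walk.length_cons, ← hl]
      ring

namespace IsEdgeFlip

variable {P Q : ConvexPolytope d n} {p q : P.Vertex} {B : Set (Fin n)} {a i : Fin n}

/-- When the geodesic traverses pq, both outer pieces are redirected to new vertices, and a single
step between these costs no more than the traversal. -/
theorem edist_le_of_hasGoodGeodesic (h : IsEdgeFlip P Q p q B a i) {x y : P.Vertex}
    (hxp : x ≠ p) (hxq : x ≠ q) (hyp : y ≠ p) (hyq : y ≠ q) (good : P.HasGoodGeodesic p q x y)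
    {x' y' : Q.Vertex} (hx : x'.active = x.active) (hy : y'.active = y.active) :
    Q.graph.edist x' y' ≤ P.graph.edist x y := by
  obtain ⟨γ, hγ, hpq⟩ := good
  -- `dist` is 0 on unreachable pairs, so γ is needed as a witness to pass to `edist`.
  rw [← SimpleGraph.Reachable.coe_dist_eq_edist ⟨γ⟩, ← hγ]
  rcases hpq with hpq | ⟨hp, hq⟩
  · obtain ⟨u, v, hu, hv, α, β, hl⟩ := exists_split_of_mem_edges γ hpq
    obtain ⟨b, -, z, hz, hd⟩ := h.exists_edist_new_le_length α hxp hxq hu hx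
    obtain ⟨c, -, w, hw, hd'⟩ := h.exists_edist_new_le_length β.reverse hyp hyq hv hy
    rw [SimpleGraph.Walk.length_reverse, SimpleGraph.edist_comm] at hd'
    rw [← hl]
    push_cast
    exact SimpleGraph.edist_triangle.trans (add_le_add
      (SimpleGraph.edist_triangle.trans (add_le_add hd (edist_new_le_one hz hw))) hd')
  · exact h.edist_le_length_of_notMem_support γ hp hq hx hy

/-- A geodesic to an end touches the edge, so being good it traverses it. The step spent on the
traversal pays for moving from the first new vertex reached to z. -/
theorem edist_new_le_of_hasGoodGeodesic (h : IsEdgeFlip P Q p q B a i) {x y : P.Vertex}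
    (hxp : x ≠ p) (hxq : x ≠ q) (hy : y = p ∨ y = q) (good : P.HasGoodGeodesic p q x y)
    {x' z : Q.Vertex} (hx : x'.active = x.active) {b : Fin n}
    (hz : z.active = insert a (insert i (B \ {b}))) :
    Q.graph.edist x' z ≤ P.graph.edist x y := by
  obtain ⟨γ, hγ, hpq⟩ := good
  rw [← SimpleGraph.Reachable.coe_dist_eq_edist ⟨γ⟩, ← hγ]
  have hmem : s(p, q) ∈ γ.edges := by
    refine hpq.resolve_right fun hn => ?_
    rcases hy with rfl | rfl
    · exact hn.1 γ.end_mem_support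
    · exact hn.2 γ.end_mem_support
  obtain ⟨u, v, hu, hv, α, β, hl⟩ := exists_split_of_mem_edges γ hmem
  obtain ⟨c, -, w, hw, hd⟩ := h.exists_edist_new_le_length α hxp hxq hu hx
  refine (SimpleGraph.edist_triangle.trans (add_le_add hd (edist_new_le_one hw hz))).trans ?_
  rw [← hl]
  exact_mod_cast Nat.le_add_right _ _

theorem ediam_le (h : IsEdgeFlip P Q p q B a i) (good : P.IsGoodEdge p q) :
    Q.graph.ediam ≤ P.graph.ediam := by
  have key : ∀ (x : P.Vertex) (x' z : Q.Vertex), x ≠ p → x ≠ q → x'.active = x.active → ∀ b,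
      z.active = insert a (insert i (B \ {b})) → Q.graph.edist x' z ≤ P.graph.ediam := by
    intro x x' z hxp hxq hx b hz
    rcases good.2 x hxp hxq with hg | hg
    · exact (h.edist_new_le_of_hasGoodGeodesic hxp hxq (Or.inl rfl) hg hx hz).trans
        SimpleGraph.edist_le_ediam
    · exact (h.edist_new_le_of_hasGoodGeodesic hxp hxq (Or.inr rfl) hg hx hz).trans
        SimpleGraph.edist_le_ediam
  refine SimpleGraph.ediam_le_of_edist_le fun z w => ?_
  rcases h.old_or_new z with ⟨x, hxp, hxq, hx⟩ | ⟨b, hb, hz⟩ <;>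
    rcases h.old_or_new w with ⟨y, hyp, hyq, hy⟩ | ⟨c, hc, hw⟩
  · exact (h.edist_le_of_hasGoodGeodesic hxp hxq hyp hyq (good.1 x y hxp hxq hyp hyq) hx hy).trans
      SimpleGraph.edist_le_ediam
  · exact key x z w hxp hxq hx c hw
  · rw [SimpleGraph.edist_comm]
    exact key y w z hyp hyq hy b hz
  -- Two new vertices are at distance at most 1, the distance from p to q, so the old diameter is at
  -- least that.
  · refine (edist_new_le_one hz hw).trans ?_
    have hpq : P.graph.edist p q = 1 := by
      refine SimpleGraph.edist_eq_one_iff_adj.2 (adj_of_active_diff_subset ?_ (k := a) ?_)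
      · rintro rfl
        have : a ∈ insert i B := h.active_right ▸ h.active_left ▸ Set.mem_insert a B
        exact this.elim h.ne h.left_notMem
      · rw [h.active_left, h.active_right]
        rintro j ⟨hj | hj, hja⟩
        · exact absurd hj hja
        · exact Or.inr hj
    rw [← hpq]
    exact SimpleGraph.edist_le_ediam

end IsEdgeFlip

end ConvexPolytope

/-! ### Geometry of a fundamental deformation -/

namespace ConvexPolytope

open HalfspaceSystem

variable {d n : ℕ}

namespace IsFundamentalDeformation

variable {P : unitInterval → ConvexPolytope d n} {i : Fin n} {t₀ : unitInterval}
  {p q : (P 0).Vertex}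

theorem normal_eq (h : IsFundamentalDeformation P i t₀ p q) {j : Fin n} (hj : j ≠ i)
    (s t : unitInterval) : (P s).normal j = (P t).normal j :=
  (h.fixed j hj s).1.trans (h.fixed j hj t).1.symm

theorem offset_eq (h : IsFundamentalDeformation P i t₀ p q) {j : Fin n} (hj : j ≠ i)
    (s t : unitInterval) : (P s).offset j = (P t).offset j :=
  (h.fixed j hj s).2.trans (h.fixed j hj t).2.symm

theorem mem_active_iff (h : IsFundamentalDeformation P i t₀ p q) {j : Fin n} (hj : j ≠ i)
    (s t : unitInterval) (x : EuclideanSpace ℝ (Fin d)) :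
    j ∈ (P s).toHalfspaceSystem.active x ↔ j ∈ (P t).toHalfspaceSystem.active x := by
  rw [mem_active, mem_active, h.normal_eq hj s t, h.offset_eq hj s t]

/-- The facets through a point off the moving hyperplane. -/
theorem active_subset (h : IsFundamentalDeformation P i t₀ p q) {s : unitInterval}
    (t : unitInterval) {x : EuclideanSpace ℝ (Fin d)} {S : Set (Fin n)}
    (hS : S ⊆ (P s).toHalfspaceSystem.active x) (hi : i ∉ S) :
    S ⊆ (P t).toHalfspaceSystem.active x := fun _ hj =>
  (h.mem_active_iff (fun hji => hi (hji ▸ hj)) t s x).2 (hS hj)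

theorem mem_carrier (h : IsFundamentalDeformation P i t₀ p q) {s t : unitInterval}
    {x : EuclideanSpace ℝ (Fin d)} (hx : x ∈ (P s).carrier)
    (hi : inner ℝ ((P t).normal i) x ≤ (P t).offset i) : x ∈ (P t).carrier := by
  intro j
  by_cases hj : j = i
  · rw [hj]; exact hi
  · rw [h.normal_eq hj t s, h.offset_eq hj t s]; exact hx j

theorem isSimple_zero (h : IsFundamentalDeformation P i t₀ p q) : (P 0).IsSimple :=
  (h.isSimple_iff 0).2 h.pos.ne

theorem isSimple_one (h : IsFundamentalDeformation P i t₀ p q) : (P 1).IsSimple :=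
  (h.isSimple_iff 1).2 h.lt_one.ne'

theorem subset_zero (h : IsFundamentalDeformation P i t₀ p q) (t : unitInterval) :
    (P t).carrier ⊆ (P 0).carrier :=
  h.antitone (zero_le : (0 : unitInterval) ≤ t)

/-- A vertex that the moving hyperplane does not meet stays on its inner side. -/
theorem inner_lt (h : IsFundamentalDeformation P i t₀ p q) {u : (P 0).Vertex}
    (hu : ∀ t, u.point ∉ (P t).hyperplane i) (t : unitInterval) :
    inner ℝ ((P t).normal i) u.point < (P t).offset i := by
  have hn := h.continuous_normal
  have ho := h.continuous_offset
  have hcont : Continuous fun t => (P t).offset i - inner ℝ ((P t).normal i) u.point := by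
    fun_prop
  have h0 : 0 < (P 0).offset i - inner ℝ ((P 0).normal i) u.point :=
    sub_pos.2 (u.inner_lt (hu 0))
  by_contra! hle
  obtain ⟨s, hs⟩ := mem_range_of_exists_le_of_exists_ge hcont (c := 0) ⟨t, by linarith⟩
    ⟨0, h0.le⟩
  exact hu s (sub_eq_zero.1 hs).symm

/-- The edge from the passed vertex `v` to a neighbour `w` on the moving facet vanishes. -/
theorem edgeVanishes (h : IsFundamentalDeformation P i t₀ p q) {v w : (P 0).Vertex} {k : Fin n}
    (hvi : i ∉ v.active) (hv : (P 1).offset i < inner ℝ ((P 1).normal i) v.point)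
    (hw : w.active = insert i (v.active \ {k})) : EdgeVanishes (P 0) (P 1) v w := by
  have hne : v ≠ w := by
    rintro rfl
    exact hvi (hw ▸ Set.mem_insert i _)
  have hsub : v.active \ {k} ⊆ w.active := hw ▸ Set.subset_insert _ _
  refine ⟨adj_of_active_diff_subset hne hsub, ?_⟩
  rintro ⟨z, hz, hzj⟩
  have hz' : v.active \ {k} ⊆ (P 0).toHalfspaceSystem.active z :=
    h.active_subset (s := 1) 0 (fun j hj => hzj j hj.1 (hsub hj)) fun hi => hvi hi.1
  have hseg := Vertex.mem_segment hne hsub (h.subset_zero 1 hz) hz'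
  rw [segment_eq_image'] at hseg
  obtain ⟨θ, ⟨hθ0, hθ1⟩, rfl⟩ := hseg
  set e := w.point - v.point with he
  -- the moving constraint weakens along the edge at time `1`, but not at time `0`
  have hz1 := hz i
  rw [inner_add_right, inner_smul_right] at hz1
  have hneg : inner ℝ ((P 1).normal i) e < 0 := by
    by_contra! hcon
    have := mul_nonneg hθ0 hcon
    linarith
  have hwi : inner ℝ ((P 0).normal i) w.point = (P 0).offset i :=
    Vertex.mem_active.1 (hw ▸ Set.mem_insert i _ : i ∈ w.active)
  have hw1 : w.point ∈ (P 1).carrier := by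
    refine h.mem_carrier w.mem_carrier ?_
    have hwe : w.point = (v.point + θ • e) + (1 - θ) • e := by
      rw [he]
      module
    rw [hwe, inner_add_right, inner_smul_right, inner_add_right, inner_smul_right]
    have := mul_nonpos_of_nonneg_of_nonpos (sub_nonneg.2 hθ1) hneg.le
    linarith
  -- At time 1 every constraint active at w is nonincreasing along e, so one can go beyond w inside
  -- P 1. But beyond w the line leaves P 0, contradicting P 1 ⊆ P 0.
  obtain ⟨s, hs, hmem⟩ := exists_add_smul_mem (P := (P 1).toHalfspaceSystem) (e := e) hw1
    fun j hj => by
      by_cases hji : j = i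
      · rw [hji]; exact hneg.le
      · have hjw : j ∈ w.active := (h.mem_active_iff hji 1 0 _).1 hj
        have hjv : j ∈ v.active := by
          rw [hw] at hjw
          exact (hjw.resolve_left hji).1
        rw [h.normal_eq hji 1 0, he, inner_sub_right, Vertex.mem_active.1 hjw,
          Vertex.mem_active.1 hjv, sub_self]
  have h0 := h.subset_zero 1 hmem i
  rw [inner_add_right, inner_smul_right, hwi, he, inner_sub_right, hwi] at h0
  have := mul_pos hs (sub_pos.2 (v.inner_lt hvi))
  linarith

/-- Some neighbour of the passed vertex lies on the moving facet. -/
theorem exists_neighbor_mem (hd : 2 ≤ d) (h : IsFundamentalDeformation P i t₀ p q)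
    {v : (P 0).Vertex} (hvi : i ∉ v.active) (hvt : v.point ∈ (P t₀).hyperplane i)
    (hlt : ∀ u : (P 0).Vertex, i ∉ u.active → u ≠ v →
      inner ℝ ((P t₀).normal i) u.point < (P t₀).offset i) :
    ∃ k ∈ v.active, ∃ w : (P 0).Vertex, w.active = insert i (v.active \ {k}) := by
  classical
  by_contra! hcon
  have hS := h.isSimple_zero
  obtain ⟨e, he⟩ := hS.exists_direction v
  -- Every neighbour of v is now strictly inside the moving half-space at time t₀ while v is on its
  -- boundary, so the moving functional decreases along all edges at v.
  have hneg : ∀ k ∈ v.active, inner ℝ ((P t₀).normal i) (e k) < 0 := by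
    intro k hk
    obtain ⟨w, hkw, j, hj, hw⟩ := hS.exists_neighbor v hk
    have hji : j ≠ i := by
      rintro rfl
      exact hcon k hk w hw
    have hiw : i ∉ w.active := by
      rw [hw]
      rintro (hij | hi)
      · exact hji hij.symm
      · exact hvi hi.1
    have hwv : w ≠ v := by
      rintro rfl
      exact hkw hk
    have h1 := hlt w hiw hwv
    have h2 : inner ℝ ((P t₀).normal i) v.point = (P t₀).offset i := hvt
    set c := inner ℝ ((P 0).normal k) (w.point - v.point) with hc
    have hc0 : c < 0 := by
      rw [hc, inner_sub_right, Vertex.mem_active.1 hk]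
      exact sub_neg.2 (w.inner_lt hkw)
    have hwe : (w.point - v.point) + c • e k = 0 := by
      refine v.eq_zero_of_inner fun l hl => ?_
      rw [inner_add_right, inner_smul_right, he k hk l hl]
      split_ifs with hlk
      · rw [hlk, ← hc]; ring
      · have hlw : l ∈ w.active := hw ▸ Or.inr ⟨hl, hlk⟩
        rw [inner_sub_right, Vertex.mem_active.1 hl, Vertex.mem_active.1 hlw]; ring
    have h3 := congrArg (fun g => inner ℝ ((P t₀).normal i) g) hwe
    simp only [inner_add_right, inner_sub_right, inner_smul_right, inner_zero_right] at h3
    by_contra! hge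
    have := mul_nonpos_of_nonpos_of_nonneg hc0.le hge
    linarith
  -- P t₀ lies in the cone at v spanned by the e k, and on that cone the moving functional attains
  -- its maximum only at v. A single point has dimension 0, not d - 1 ≥ 1.
  have hfacet : (P t₀).facet i ⊆ {v.point} := by
    rintro x ⟨hx, hxi⟩
    have hx0 := h.subset_zero t₀ hx
    have hsum : (x - v.point) + ∑ k ∈ v.active.toFinset,
        inner ℝ ((P 0).normal k) (x - v.point) • e k = 0 := by
      refine v.eq_zero_of_inner fun l hl => ?_
      rw [inner_add_right, inner_sum, Finset.sum_eq_single l]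
      · rw [inner_smul_right, he l hl l hl, if_pos rfl]; ring
      · intro k hk hkl
        rw [inner_smul_right, he k (Set.mem_toFinset.1 hk) l hl, if_neg hkl.symm, mul_zero]
      · intro hl'
        exact absurd (Set.mem_toFinset.2 hl) hl'
    have h3 := congrArg (fun g => inner ℝ ((P t₀).normal i) g) hsum
    have h2 : inner ℝ ((P t₀).normal i) v.point = (P t₀).offset i := hvt
    have h4 : inner ℝ ((P t₀).normal i) x = (P t₀).offset i := hxi
    simp only [inner_add_right, inner_sum, inner_smul_right, inner_zero_right] at h3
    rw [inner_sub_right ((P t₀).normal i), h2, h4, sub_self, zero_add] at h3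
    have hle : ∀ k ∈ v.active, inner ℝ ((P 0).normal k) (x - v.point) ≤ 0 := fun k hk => by
      rw [inner_sub_right, Vertex.mem_active.1 hk]
      exact sub_nonpos.2 (hx0 k)
    rw [Finset.sum_eq_zero_iff_of_nonneg fun k hk => mul_nonneg_of_nonpos_of_nonpos
      (hle k (Set.mem_toFinset.1 hk)) (hneg k (Set.mem_toFinset.1 hk)).le] at h3
    refine sub_eq_zero.1 (v.eq_zero_of_inner fun k hk => ?_)
    exact (mul_eq_zero.1 (h3 k (Set.mem_toFinset.2 hk))).resolve_right (hneg k hk).ne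
  have hbot : vectorSpan ℝ ((P t₀).facet i) = ⊥ := by
    rw [eq_bot_iff, ← vectorSpan_singleton (k := ℝ) v.point]
    exact vectorSpan_mono ℝ hfacet
  have := (P t₀).finrank_facet i
  rw [hbot, finrank_bot] at this
  omega

/-- A vertex off the moving hyperplane persists as long as it is not cut off. -/
theorem exists_vertex_of_le (h : IsFundamentalDeformation P i t₀ p q) {s t : unitInterval}
    (hs : (P s).IsSimple) (ht : (P t).IsSimple) {u : (P s).Vertex} (hi : i ∉ u.active)
    (hle : inner ℝ ((P t).normal i) u.point ≤ (P t).offset i) :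
    ∃ u' : (P t).Vertex, u'.point = u.point ∧ u'.active = u.active := by
  have hmem := h.mem_carrier u.mem_carrier hle
  have hact := h.active_subset t (subset_refl u.active) hi
  have hext : u.point ∈ (P t).carrier.extremePoints ℝ :=
    (mem_extremePoints_iff hmem).2 fun e he => u.eq_zero_of_inner fun j hj => by
      rw [h.normal_eq (fun hji => hi (hji ▸ hj)) s t]
      exact he j (hact hj)
  exact ⟨⟨u.point, hext⟩, rfl, ht.active_eq ⟨u.point, hext⟩ hact (hs.ncard_active u).ge⟩

/-- The moving hyperplane cuts an edge at a vertex. -/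
theorem exists_vertex_of_mem_segment (h : IsFundamentalDeformation P i t₀ p q) {v u : (P 0).Vertex}
    {k : Fin n} (hk : k ∈ v.active) (hvi : i ∉ v.active) (hsub : v.active \ {k} ⊆ u.active)
    (hv : (P 1).offset i < inner ℝ ((P 1).normal i) v.point)
    (hu : inner ℝ ((P 1).normal i) u.point < (P 1).offset i) :
    ∃ z : (P 1).Vertex, z.active = insert i (v.active \ {k}) := by
  set g := inner ℝ ((P 1).normal i) v.point with hg
  set g' := inner ℝ ((P 1).normal i) u.point with hg'
  set c := (P 1).offset i with hc
  have hpos : 0 < g - g' := by linarith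
  -- The parameter at which the moving functional, going linearly from g at v to g' at u, takes the
  -- value c.
  set θ := (g - c) / (g - g') with hθ
  have hθ0 : 0 ≤ θ := div_nonneg (by linarith) hpos.le
  have hθ1 : θ ≤ 1 := (div_le_one hpos).2 (by linarith)
  set x := v.point + θ • (u.point - v.point) with hx
  have hxi : inner ℝ ((P 1).normal i) x = c := by
    rw [hx, inner_add_right, inner_smul_right, inner_sub_right, ← hg, ← hg', hθ]
    field_simp
    ring
  have hx0 : x ∈ (P 0).carrier := by
    intro j
    have h1 := v.mem_carrier j
    have h2 := u.mem_carrier j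
    rw [hx, inner_add_right, inner_smul_right, inner_sub_right]
    nlinarith
  have hx1 : x ∈ (P 1).carrier := h.mem_carrier hx0 hxi.le
  have hact0 : v.active \ {k} ⊆ (P 0).toHalfspaceSystem.active x := fun j hj => by
    rw [mem_active, hx, inner_add_right, inner_smul_right, inner_sub_right,
      Vertex.mem_active.1 (hsub hj), Vertex.mem_active.1 hj.1]
    ring
  have hact : insert i (v.active \ {k}) ⊆ (P 1).toHalfspaceSystem.active x :=
    Set.insert_subset hxi (h.active_subset 1 hact0 fun hi => hvi hi.1)
  have hsimple := h.isSimple_zero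
  obtain ⟨e, he⟩ := hsimple.exists_direction v
  have hkk := he k hk k hk
  rw [if_pos rfl] at hkk
  have hline : ∀ f, (∀ j ∈ v.active \ {k}, inner ℝ ((P 0).normal j) f = 0) →
      f = (-inner ℝ ((P 0).normal k) f) • e k := by
    intro f hf
    rw [neg_smul, eq_neg_iff_add_eq_zero]
    refine v.eq_zero_of_inner fun l hl => ?_
    rw [inner_add_right, inner_smul_right, he k hk l hl]
    split_ifs with hlk
    · rw [hlk]; ring
    · rw [hf l ⟨hl, hlk⟩]; ring
  -- The functional separates v from u, so it is not constant along the edge; this makes the cut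
  -- point extreme.
  have hei : inner ℝ ((P 1).normal i) (e k) ≠ 0 := by
    intro h0
    have h1 := hline (u.point - v.point) fun j hj => by
      rw [inner_sub_right, Vertex.mem_active.1 (hsub hj), Vertex.mem_active.1 hj.1, sub_self]
    have h2 := congrArg (fun g => inner ℝ ((P 1).normal i) g) h1
    simp only [inner_smul_right, h0, mul_zero] at h2
    rw [inner_sub_right, ← hg, ← hg'] at h2
    linarith
  have hext : x ∈ (P 1).carrier.extremePoints ℝ := by
    refine (mem_extremePoints_iff hx1).2 fun f hf => ?_
    have h1 := hline f fun j hj => by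
      rw [h.normal_eq (fun hji => hvi (hji ▸ hj.1)) 0 1]
      exact hf j (hact (Or.inr hj))
    have h2 := hf i (hact (Or.inl rfl))
    rw [h1, inner_smul_right] at h2
    rw [h1, (mul_eq_zero.1 h2).resolve_right hei, zero_smul]
  refine ⟨⟨x, hext⟩, h.isSimple_one.active_eq ⟨x, hext⟩ hact ?_⟩
  rw [Set.ncard_insert_of_notMem (fun hi => hvi hi.1), Set.ncard_sdiff_singleton_add_one hk,
    hsimple.ncard_active v]

end IsFundamentalDeformation
end ConvexPolytope

/-! ### A fundamental deformation is an edge flip -/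

namespace ConvexPolytope

open HalfspaceSystem

variable {d n : ℕ}

namespace IsFundamentalDeformation

variable {P : unitInterval → ConvexPolytope d n} {i : Fin n} {t₀ : unitInterval}
  {p q : (P 0).Vertex}

/-- A vertex on the moving facet persists if the other end of the edge that leaves this facet
does. -/
theorem exists_vertex_of_neighbor (h : IsFundamentalDeformation P i t₀ p q) {x u : (P 0).Vertex}
    {j : Fin n} (hx : i ∈ x.active) (hj : j ∉ x.active) (hu : u.active = insert j (x.active \ {i}))
    (hiu : i ∉ u.active) (hlt : inner ℝ ((P 1).normal i) u.point < (P 1).offset i) :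
    ∃ x' : (P 1).Vertex, x'.active = x.active := by
  obtain ⟨u', hpt, hact⟩ := h.exists_vertex_of_le h.isSimple_zero h.isSimple_one hiu hlt.le
  have hju : j ∈ u.active := hu ▸ Set.mem_insert j _
  have hdiff : u.active \ {j} = x.active \ {i} := by
    rw [hu, Set.insert_sdiff_self_of_notMem fun hmem => hj hmem.1]
  obtain ⟨y, -, l, hl, hy⟩ := h.isSimple_one.exists_neighbor u' (hact ▸ hju)
  rw [hact] at hl
  rw [hact, hdiff] at hy
  refine ⟨y, ?_⟩
  suffices hli : l = i by rw [hy, hli, Set.insert_sdiff_singleton, Set.insert_eq_of_mem hx]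
  -- The edge of P 1 from u' back towards x stays on the segment ux. A fixed hyperplane l missing
  -- both u and x cannot meet this segment, so the edge can end only on the moving facet.
  by_contra hli
  have hux : u ≠ x := fun hux => hiu (hux ▸ hx)
  have hsub : u.active \ {j} ⊆ (P 0).toHalfspaceSystem.active y.point :=
    h.active_subset (s := 1) 0 (hdiff ▸ hy ▸ Set.subset_insert _ _ : _ ⊆ y.active)
      fun hmem => hiu hmem.1
  have hly : l ∈ (P 0).toHalfspaceSystem.active y.point :=
    (h.mem_active_iff hli 1 0 _).1 (hy ▸ Set.mem_insert l _ : l ∈ y.active)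
  have hseg := Vertex.mem_segment hux (hdiff ▸ Set.sdiff_subset)
    (h.subset_zero 1 y.mem_carrier) hsub
  have hlx : l ∉ x.active := fun hlx => hl (hu ▸ Or.inr ⟨hlx, hli⟩)
  obtain ⟨a, b, ha, hb, hab, hys⟩ := hseg
  rw [HalfspaceSystem.mem_active, ← hys, inner_add_right, inner_smul_right,
    inner_smul_right] at hly
  have h1 := u.inner_lt hl
  have h2 := x.inner_lt hlx
  rcases ha.eq_or_lt with rfl | ha
  · rw [zero_add] at hab
    rw [hab] at hly
    linarith
  · have h3 := mul_lt_mul_of_pos_left h1 ha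
    have h4 := mul_le_mul_of_nonneg_left h2.le hb
    have h5 : a * (P 0).offset l + b * (P 0).offset l = (P 0).offset l := by
      rw [← add_mul, hab, one_mul]
    linarith

theorem exists_isEdgeFlip (hd : 2 ≤ d) (h : IsFundamentalDeformation P i t₀ p q) :
    ∃ B a b, IsEdgeFlip (P 0) (P 1) p q B a b := by
  obtain ⟨v, hvi, hvt, hvout, hpass⟩ := h.passed
  replace hvi : i ∉ v.active := hvi
  have hS := h.isSimple_zero
  have hv1 : (P 1).offset i < inner ℝ ((P 1).normal i) v.point := by
    by_contra! hle
    exact hvout 1 h.lt_one (h.mem_carrier v.mem_carrier hle)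
  have hlt : ∀ u : (P 0).Vertex, i ∉ u.active → u ≠ v → ∀ t,
      inner ℝ ((P t).normal i) u.point < (P t).offset i := fun u hu huv =>
    h.inner_lt fun t ht => huv (hpass u hu ⟨t, ht⟩)
  obtain ⟨a, ha, w, hw⟩ := h.exists_neighbor_mem hd hvi hvt fun u hu huv => hlt u hu huv t₀
  have hwi : i ∈ w.active := hw ▸ Set.mem_insert i _
  have hvw : s(v, w) = s(p, q) := (h.vanishing v w).1 (h.edgeVanishes hvi hv1 hw)
  have hne : v ≠ w := fun hvw => hvi (hvw ▸ hwi)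
  -- Each neighbour of v on the moving facet gives a vanishing edge, and only one edge vanishes.
  have huniq : ∀ (u : (P 0).Vertex) (k : Fin n), u.active = insert i (v.active \ {k}) →
      u = w := fun u k hu => by
    have := ((h.vanishing v u).1 (h.edgeVanishes hvi hv1 hu)).trans hvw.symm
    exact Sym2.congr_right.1 this
  have hBw : v.active \ {a} ⊆ w.active := hw ▸ Set.subset_insert _ _
  have hnot : ∀ x : (P 0).Vertex, x ≠ v → x ≠ w → ¬ v.active \ {a} ⊆ x.active :=
    fun x hxv hxw hsub => hxw (Vertex.eq_of_active_diff_subset hne hxv.symm hBw hsub)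
  have hset : ∀ b ∈ v.active \ {a},
      insert a (insert i ((v.active \ {a}) \ {b})) = insert i (v.active \ {b}) := by
    rintro b ⟨hb, hba⟩
    rw [Set.insert_comm, Set.sdiff_sdiff_comm, Set.insert_sdiff_singleton,
      Set.insert_eq_of_mem (show a ∈ v.active \ {b} from ⟨ha, fun hab => hba hab.symm⟩)]
  have hflip : IsEdgeFlip (P 0) (P 1) v w (v.active \ {a}) a i :=
    { isSimple := hS
      ne := fun hai => hvi (hai ▸ ha)
      left_notMem := fun hmem => hmem.2 rfl
      right_notMem := fun hmem => hvi hmem.1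
      active_left := by rw [Set.insert_sdiff_singleton, Set.insert_eq_of_mem ha]
      active_right := hw
      not_subset := hnot
      exists_old := by
        intro x hxv hxw
        by_cases hxi : i ∈ x.active
        · obtain ⟨u, hiu, j, hj, hu⟩ := hS.exists_neighbor x hxi
          -- The neighbour u of x off the moving facet is not v, since otherwise x would be w.
          refine h.exists_vertex_of_neighbor hxi hj hu hiu (hlt u hiu ?_ 1)
          rintro rfl
          refine hxw (huniq x j ?_)
          rw [hu, Set.insert_sdiff_self_of_notMem fun hmem => hj hmem.1,
            Set.insert_sdiff_singleton, Set.insert_eq_of_mem hxi]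
        · obtain ⟨x', -, hx'⟩ :=
            h.exists_vertex_of_le hS h.isSimple_one hxi (hlt x hxi hxv 1).le
          exact ⟨x', hx'⟩
      exists_new := by
        intro b hb
        rw [hset b hb]
        obtain ⟨u, hbu, j, hj, hu⟩ := hS.exists_neighbor v hb.1
        -- The edge leaving facet b at v does not end on the moving facet: its end would be w, which
        -- lies on b. So it runs from the cut-off vertex v to a surviving one, and the moving
        -- hyperplane cuts it in the new vertex.
        have hji : j ≠ i := by
          rintro rfl
          have hwb : b ∈ w.active := hBw hb
          exact hbu (huniq u b hu ▸ hwb)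
        have hiu : i ∉ u.active := by
          rw [hu]
          rintro (hij | hmem)
          · exact hji hij.symm
          · exact hvi hmem.1
        exact h.exists_vertex_of_mem_segment hb.1 hvi (hu ▸ Set.subset_insert _ _) hv1
          (hlt u hiu (fun huv => hbu (huv ▸ hb.1)) 1)
      old_or_new := by
        have hoff : ∀ z : (P 1).Vertex, i ∉ z.active → ∃ x : (P 0).Vertex, x ≠ v ∧ x ≠ w ∧
            z.active = x.active := by
          intro z hz
          obtain ⟨x, hxz, hact⟩ := h.exists_vertex_of_le h.isSimple_one hS hz
            (h.subset_zero 1 z.mem_carrier i)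
          refine ⟨x, ?_, ?_, hact.symm⟩
          · rintro rfl
            exact hvout 1 h.lt_one (hxz ▸ z.mem_carrier)
          · rintro rfl
            exact hz (hact ▸ hwi)
        intro z
        by_cases hz : i ∈ z.active
        · obtain ⟨u', hiu', j, hj, hu'⟩ := h.isSimple_one.exists_neighbor z hz
          obtain ⟨u, huv, huw, hact⟩ := hoff u' hiu'
          have hu : u.active = insert j (z.active \ {i}) := hact ▸ hu'
          have hiu : i ∉ u.active := hact ▸ hiu'
          have hdiff : u.active \ {j} = z.active \ {i} := by
            rw [hu, Set.insert_sdiff_self_of_notMem fun hmem => hj hmem.1]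
          have hzi : insert i (z.active \ {i}) = z.active := by
            rw [Set.insert_sdiff_singleton, Set.insert_eq_of_mem hz]
          -- From z an edge of P 1 leads off the moving facet to an old vertex u; let x be the other
          -- end of the corresponding edge of P 0. If x is on the moving facet, then z has the
          -- facets of x; if x = v, then z is the new point cut on the edge uv. Otherwise u and x
          -- are both strictly inside at time 1, and z between them cannot lie on the moving
          -- hyperplane.
          obtain ⟨x, hjx, l, hl, hx⟩ := hS.exists_neighbor u (hu ▸ Set.mem_insert j _)
          have hlz : l ∉ z.active \ {i} := fun hmem => hl (hu ▸ Or.inr hmem)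
          rw [hdiff] at hx
          by_cases hli : l = i
          · rw [hli, hzi] at hx
            refine Or.inl ⟨x, ?_, ?_, hx.symm⟩
            · rintro rfl
              exact hvi (hx ▸ hz)
            · rintro rfl
              refine hnot u huv huw ?_
              have hsub : v.active \ {a} = z.active \ {i} := by
                rw [← hx, hw, Set.insert_sdiff_self_of_notMem fun hmem => hvi hmem.1]
              rw [hsub, hu]
              exact Set.subset_insert _ _
          have hix : i ∉ x.active := by
            rw [hx]
            rintro (hil | hmem)
            · exact hli hil.symm
            · exact hmem.2 rfl
          by_cases hxv : x = v
          · subst hxv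
            have hxl : x.active \ {l} = z.active \ {i} := by
              rw [hx, Set.insert_sdiff_self_of_notMem hlz]
            have hlB : l ∈ x.active \ {a} := by
              refine ⟨hx ▸ Set.mem_insert l _, ?_⟩
              rintro rfl
              refine hnot u huv huw ?_
              rw [hxl, hu]
              exact Set.subset_insert _ _
            refine Or.inr ⟨l, hlB, ?_⟩
            rw [hset l hlB, hxl, hzi]
          · exfalso
            have hux : u ≠ x := by
              rintro rfl
              exact hjx (hu ▸ Set.mem_insert j _)
            have hseg := Vertex.mem_segment (z := z.point) hux
              (k := j) (hdiff ▸ hx ▸ Set.subset_insert _ _) (h.subset_zero 1 z.mem_carrier)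
              (h.active_subset (s := 1) 0 (hdiff ▸ Set.sdiff_subset : _ ⊆ z.active)
                fun hmem => hiu hmem.1)
            obtain ⟨b, c, hb, hc, hbc, hzs⟩ := hseg
            have h1 := hlt u hiu huv 1
            have h2 := hlt x hix hxv 1
            have h3 := Vertex.mem_active.1 hz
            rw [← hzs, inner_add_right, inner_smul_right, inner_smul_right] at h3
            have hconv := (convex_Iio ((P 1).offset i)) h1 h2 hb hc hbc
            exact hconv.ne h3
        · exact Or.inl (hoff z hz) }
  rcases Sym2.eq_iff.1 hvw with ⟨rfl, rfl⟩ | ⟨rfl, rfl⟩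
  · exact ⟨_, _, _, hflip⟩
  · exact ⟨_, _, _, hflip.symm⟩

end IsFundamentalDeformation

/-! ### Invariance under one good step, and iteration -/

theorem GoodStep.isHirsch (hd : 2 ≤ d) {P Q : ConvexPolytope d n} (h : GoodStep P Q)
    (hP : P.IsHirsch) : Q.IsHirsch := by
  obtain ⟨P, i, t₀, p, q, hdef, good⟩ := h
  obtain ⟨B, a, b, hflip⟩ := hdef.exists_isEdgeFlip hd
  exact (add_le_add_left (hflip.ediam_le good) _).trans hP

end ConvexPolytope

theorem MarkedPolytope.GoodStep.isDantzigHirsch {d : ℕ} (hd : 2 ≤ d)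
    {A B : MarkedPolytope d (2 * d)} (h : GoodStep A B) (hA : A.IsDantzigHirsch) :
    B.IsDantzigHirsch := by
  obtain ⟨P, i, t₀, p, q, hdef, x, y, hxp, hxq, hyp, hyq, good, x', y', hx', hy'⟩ := h
  obtain ⟨⟨-, hxy⟩, hdist⟩ := hA
  obtain ⟨B, a, b, hflip⟩ := hdef.exists_isEdgeFlip hd
  exact ⟨⟨hdef.isSimple_one, fun j => (hx' j).trans ((hxy j).trans (not_congr (hy' j).symm))⟩,
    (hflip.edist_le_of_hasGoodGeodesic hxp hxq hyp hyq good (Set.ext hx') (Set.ext hy')).trans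
      hdist⟩

theorem mainTheorem4 (d : ℕ) (hd : 3 ≤ d) :
    (∀ (n : ℕ) (P Q : ConvexPolytope d n),
      P.IsHirsch → P.IsGoodDeformation Q → Q.IsHirsch) ∧
    (∀ A B : MarkedPolytope d (2 * d),
      A.IsDantzigHirsch → A.IsGoodDeformation B → B.IsDantzigHirsch) := by
  have hd2 : 2 ≤ d := by omega
  refine ⟨fun n P Q hP hPQ => ?_, fun A B hA hAB => ?_⟩
  · induction hPQ with
    | refl => exact hP
    | tail _ h ih => exact h.isHirsch hd2 ih
  · induction hAB with
    | refl => exact hA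
    | tail _ h ih => exact h.isDantzigHirsch hd2 ih
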